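/- There is an absolute constant $c>0$ such that the following holds. Let $\mathfrak L_1,\mathfrak L_2,\mathfrak L_3$ be finite collections of $L_1,L_2,L_3$ lines, respectively, in $\mathbb R^3$, and let $J(\mathfrak L_1,\mathfrak L_2,\mathfrak L_3)$ be the set of multijoints formed by them, i.e. the set of points $x\in\mathbb R^3$ for which there exist lines $l_i\in\mathfrak L_i$ through $x$, $i=1,2,3$, such that the directions of $l_1,l_2,l_3$ span $\mathbb R^3$. Then $J(\mathfrak L_1,\mathfrak L_2,\mathfrak L_3)$ is finite and $$|J(\mathfrak L_1,\mathfrak L_2,\mathfrak L_3)|\le c\,(L_1L_2L_3)^{1/2}.$$ -/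

import Mathlib

/-- A line of `ℝ³`: an affine subspace whose direction space is one-dimensional.
(The empty affine subspace has direction `⊥`, so it is not a line.) -/
def IsLine (l : AffineSubspace ℝ (EuclideanSpace ℝ (Fin 3))) : Prop :=
  Module.finrank ℝ l.direction = 1

/-- The set of multijoints formed by three collections of lines in `ℝ³`: the points lying on
some line of each collection, such that the directions of these three lines span `ℝ³`. -/
def multijoints (A B C : Set (AffineSubspace ℝ (EuclideanSpace ℝ (Fin 3)))) :
    Set (EuclideanSpace ℝ (Fin 3)) :=
  {x | ∃ l₁ ∈ A, ∃ l₂ ∈ B, ∃ l₃ ∈ C, x ∈ l₁ ∧ x ∈ l₂ ∧ x ∈ l₃ ∧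
    l₁.direction ⊔ l₂.direction ⊔ l₃.direction = ⊤}

/-! ### Taylor coefficients in a frame adapted to a joint. -/

section AdaptedCoordinates

open MvPolynomial

variable {σ : Type*}

/-! The polynomial method, with vanishing conditions shaped to the three families. Suppose each
chosen line of family `i` carries at least `m i` joints. At every joint, in coordinates along its
own three lines, kill the Taylor coefficients in a box with sides proportional to `(∏ m) / m i`. If
joints were few compared with `∏ m`, some nonzero `f` of degree below every `m i * B i` would
satisfy this (`exists_ne_zero_coeff_frameSubst_eq_zero`).

Among all joints pick a lowest-order surviving monomial `e`; it leaves the box in some direction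
`i`. The transverse Taylor coefficient containing it restricts to a nonzero univariate polynomial on
the `i`-th line, vanishing to order `e i ≥ B i` at `m i` joints: too many zeros
(`eq_zero_of_coeff_frameSubst_eq_zero`). Pruning lines with few joints
(`exists_subset_large_fibers`) reduces to this case with `m i` about `N / (4 L_i)`, where `N` is the
number of joints. -/

theorem Polynomial.card_mul_le_natDegree_of_X_sub_C_pow_dvd {ι K : Type*} [Field K] {r : Polynomial K}
    (hr : r ≠ 0) (S : Finset ι) (s : ι → K) (hs : Set.InjOn s S) (a : ℕ)
    (h : ∀ q ∈ S, (Polynomial.X - Polynomial.C (s q)) ^ a ∣ r) :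
    S.card * a ≤ r.natDegree := by
  have hd : ∏ q ∈ S, (Polynomial.X - Polynomial.C (s q)) ^ a ∣ r := by
    refine Finset.prod_dvd_of_coprime ?_ h
    intro x hx y hy hxy
    refine IsCoprime.pow ?_
    exact Polynomial.isCoprime_X_sub_C_of_isUnit_sub
      (sub_ne_zero.2 fun e => hxy (hs hx hy e)).isUnit
  have := Polynomial.natDegree_le_of_dvd hd hr
  rwa [Polynomial.natDegree_prod_of_monic _ _ fun q _ => (Polynomial.monic_X_sub_C _).pow a,
    Finset.sum_congr rfl fun q _ => by
      rw [Polynomial.natDegree_pow, Polynomial.natDegree_X_sub_C, mul_one],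
    Finset.sum_const, smul_eq_mul] at this

theorem MvPolynomial.totalDegree_aeval_le_of_totalDegree_le_one [Fintype σ] {τ R : Type*} [CommRing R]
    (g : σ → MvPolynomial τ R) (hg : ∀ j, (g j).totalDegree ≤ 1) (f : MvPolynomial σ R) :
    (aeval g f).totalDegree ≤ f.totalDegree := by
  rw [aeval_def, eval₂_eq']
  refine totalDegree_finsetSum_le fun d hd => ?_
  refine (totalDegree_mul _ _).trans ?_
  rw [algebraMap_eq, totalDegree_C, zero_add]
  refine (totalDegree_finsetProd _ _).trans ?_
  refine le_trans ?_ (le_totalDegree hd)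
  rw [Finsupp.sum_fintype _ _ fun _ => rfl]
  refine Finset.sum_le_sum fun j _ => (totalDegree_pow _ _).trans ?_
  simpa using Nat.mul_le_mul_left (d j) (hg j)

/-- If all monomials of `h` have degree at least `k`, then substituting elements of an ideal
lands in the `k`-th power of that ideal. -/
theorem MvPolynomial.aeval_mem_ideal_pow [Fintype σ] {R A : Type*} [CommRing R] [CommRing A] [Algebra R A]
    (I : Ideal A) (g : σ → A) (hg : ∀ j, g j ∈ I) (h : MvPolynomial σ R) (k : ℕ)
    (hk : ∀ m ∈ h.support, k ≤ m.degree) : aeval g h ∈ I ^ k := by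
  rw [aeval_def, eval₂_eq']
  refine Ideal.sum_mem _ fun d hd => Ideal.mul_mem_left _ _ ?_
  refine Ideal.pow_le_pow_right (hk d hd) ?_
  rw [Finsupp.degree_eq_sum, ← Finset.prod_pow_eq_pow_sum]
  exact Ideal.prod_mem_prod fun j _ => Ideal.pow_mem_pow (hg j) _

/-- The ideal of polynomials vanishing at the point `s` of the line `X = 0`. -/
noncomputable def linePointIdeal (σ : Type*) (s : ℝ) : Ideal (MvPolynomial σ (Polynomial ℝ)) :=
  Ideal.span (insert (C (Polynomial.X - Polynomial.C s)) (Set.range X))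

variable [DecidableEq σ]

/-- Each of the `k` generator factors either supplies a factor `X - s` or raises the transverse
degree by one, so a term of transverse degree `|e|` keeps at least `k - |e|` factors `X - s`. -/
theorem coeff_dvd_of_mem_linePointIdeal_pow (s : ℝ) (k : ℕ) :
    ∀ h ∈ linePointIdeal σ s ^ k, ∀ e : σ →₀ ℕ,
      (Polynomial.X - Polynomial.C s) ^ (k - e.degree) ∣ coeff e h := by
  induction k with
  | zero => intro h _ e; simp
  | succ k ih =>
    intro h hh
    rw [pow_succ'] at hh
    induction hh using Submodule.mul_induction_on' with
    | add x _ y _ hx hy => intro e; rw [coeff_add]; exact dvd_add (hx e) (hy e)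
    | mem_mul_mem g hg h hh =>
      rw [linePointIdeal] at hg
      induction hg using Submodule.span_induction generalizing h with
      | zero => intro e; simp
      | add x y _ _ hx hy =>
        intro e; rw [add_mul, coeff_add]; exact dvd_add (hx h hh e) (hy h hh e)
      | smul r x _ hx =>
        intro e
        rw [smul_eq_mul, mul_comm r x, mul_assoc]
        exact hx _ (Ideal.mul_mem_left _ _ hh) e
      | mem x hx =>
        intro e
        rcases hx with rfl | ⟨j, rfl⟩
        · rw [coeff_C_mul]
          refine (pow_dvd_pow _ ?_).trans (pow_succ' (Polynomial.X - Polynomial.C s) _ ▸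
            mul_dvd_mul_left _ (ih h hh e))
          omega
        · rw [mul_comm, coeff_mul_X']
          split_ifs with hj
          · refine (pow_dvd_pow _ ?_).trans (ih h hh _)
            have h1 : Finsupp.single j 1 ≤ e := by
              rw [Finsupp.single_le_iff]
              exact Nat.one_le_iff_ne_zero.2 (Finsupp.mem_support_iff.1 hj)
            have h2 := congrArg Finsupp.degree (tsub_add_cancel_of_le h1)
            rw [map_add, Finsupp.degree_single] at h2
            omega
          · exact dvd_zero _

variable [Fintype σ]

/-- Regard the `i`-th variable as a coefficient. -/
noncomputable def absorbVar (i : σ) : MvPolynomial σ ℝ →ₐ[ℝ] MvPolynomial σ (Polynomial ℝ) :=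
  aeval fun k => if k = i then C Polynomial.X else X k

theorem absorbVar_eq_sum (i : σ) (h : MvPolynomial σ ℝ) :
    absorbVar i h =
      ∑ m ∈ h.support, monomial (m.erase i) (Polynomial.monomial (m i) (coeff m h)) := by
  rw [absorbVar, aeval_def, eval₂_eq']
  refine Finset.sum_congr rfl fun m _ => ?_
  rw [monomial_eq, ← Finset.mul_prod_erase _ _ (Finset.mem_univ i), if_pos rfl,
    Finsupp.prod_fintype _ _ fun _ => pow_zero _,
    ← Finset.mul_prod_erase _ _ (Finset.mem_univ i), Finsupp.erase_same, pow_zero, one_mul,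
    ← mul_assoc]
  congr 1
  · rw [← Polynomial.C_mul_X_pow_eq_monomial, C_mul, C_pow]
    rfl
  · refine Finset.prod_congr rfl fun k hk => ?_
    rw [if_neg (Finset.ne_of_mem_erase hk), Finsupp.erase_ne (Finset.ne_of_mem_erase hk)]

/-- Ensures that the transverse coefficient through a surviving monomial is nonzero. -/
theorem coeff_coeff_absorbVar (i : σ) (h : MvPolynomial σ ℝ) (m : σ →₀ ℕ) :
    (coeff (m.erase i) (absorbVar i h)).coeff (m i) = coeff m h := by
  rw [absorbVar_eq_sum, coeff_sum, Polynomial.finsetSum_coeff]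
  rw [Finset.sum_eq_single m]
  · simp
  · intro b _ hb
    rw [coeff_monomial]
    split_ifs with h1
    · rw [Polynomial.coeff_monomial, if_neg]
      intro h2
      apply hb
      ext k
      by_cases hk : k = i
      · rw [hk, h2]
      · rw [← Finsupp.erase_ne hk, h1, Finsupp.erase_ne hk]
    · simp
  · intro hm
    simp [notMem_support_iff.1 hm]

theorem natDegree_coeff_absorbVar_le (i : σ) (h : MvPolynomial σ ℝ) (e : σ →₀ ℕ) :
    (coeff e (absorbVar i h)).natDegree ≤ h.totalDegree := by
  rw [absorbVar_eq_sum, coeff_sum]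
  refine Polynomial.natDegree_sum_le_of_forall_le _ _ fun m hm => ?_
  rw [coeff_monomial]
  split_ifs
  · refine (Polynomial.natDegree_monomial_le _).trans (le_trans ?_ (le_totalDegree hm))
    rw [Finsupp.sum_fintype _ _ fun _ => rfl]
    exact Finset.single_le_sum (f := fun j => m j) (fun _ _ => Nat.zero_le _) (Finset.mem_univ i)
  · simp

/-- The polynomial `f` in the affine coordinates with origin `x` and axes the rows of `U`. -/
noncomputable def frameSubst (x : σ → ℝ) (U : Matrix σ σ ℝ) :
    MvPolynomial σ ℝ →ₐ[ℝ] MvPolynomial σ ℝ :=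
  aeval fun j => C (x j) + ∑ k, C (U k j) * X k

/-- The inverse of `frameSubst`. -/
noncomputable def frameSubstInv (x : σ → ℝ) (U : Matrix σ σ ℝ) :
    MvPolynomial σ ℝ →ₐ[ℝ] MvPolynomial σ ℝ :=
  aeval fun k => ∑ j, C (U⁻¹ j k) * (X j - C (x j))

theorem frameSubstInv_frameSubst (x : σ → ℝ) (U : Matrix σ σ ℝ) (hU : IsUnit U.det)
    (f : MvPolynomial σ ℝ) : frameSubstInv x U (frameSubst x U f) = f := by
  suffices (frameSubstInv x U).comp (frameSubst x U) = AlgHom.id ℝ _ from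
    DFunLike.congr_fun this f
  ext1 j
  simp only [AlgHom.comp_apply, frameSubst, frameSubstInv, aeval_X, map_add, map_sum, map_mul,
    algHom_C, algebraMap_eq, AlgHom.id_apply, Finset.mul_sum]
  rw [Finset.sum_comm]
  have h1 : ∀ l, ∑ k, (C (U k j) * (C (U⁻¹ l k) * (X l - C (x l))) : MvPolynomial σ ℝ) =
      C ((1 : Matrix σ σ ℝ) l j) * (X l - C (x l)) := by
    intro l
    rw [← Matrix.nonsing_inv_mul U hU, Matrix.mul_apply, map_sum, Finset.sum_mul]
    refine Finset.sum_congr rfl fun k _ => ?_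
    rw [C_mul]; ring
  rw [Finset.sum_congr rfl fun l _ => h1 l, Finset.sum_eq_single j]
  · simp
  · intro b _ hb
    simp [Matrix.one_apply_ne hb]
  · simp

omit [DecidableEq σ] in
theorem totalDegree_frameSubst_le (x : σ → ℝ) (U : Matrix σ σ ℝ) (f : MvPolynomial σ ℝ) :
    (frameSubst x U f).totalDegree ≤ f.totalDegree := by
  refine totalDegree_aeval_le_of_totalDegree_le_one _ (fun j => ?_) f
  refine (totalDegree_add _ _).trans (max_le (by simp) ?_)
  refine totalDegree_finsetSum_le fun k _ => (totalDegree_mul _ _).trans ?_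
  simp

/-- If `f` vanishes to order `k` at the point `y = x + s • U i`, then its Taylor coefficients
transverse to the line through `x` in direction `U i` vanish to the complementary order at `y`. -/
theorem pow_dvd_coeff_absorbVar_frameSubst (x y : σ → ℝ) (U V : Matrix σ σ ℝ)
    (hV : IsUnit V.det) (i : σ) (s : ℝ) (hy : y = x + s • U i) (f : MvPolynomial σ ℝ) (k : ℕ)
    (hk : ∀ m ∈ (frameSubst y V f).support, k ≤ m.degree) (e : σ →₀ ℕ) :
    (Polynomial.X - Polynomial.C s) ^ (k - e.degree) ∣
      coeff e (absorbVar i (frameSubst x U f)) := by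
  refine coeff_dvd_of_mem_linePointIdeal_pow s k _ ?_ e
  -- Expand `f` in the frame at `y`: the coordinates of that frame vanish at `y`, so restated in the
  -- frame at `x` they lie in the ideal of the point `s`. The order of vanishing does not depend on
  -- the frame.
  have key : absorbVar i (frameSubst x U f) = aeval (fun l => (absorbVar i).comp (frameSubst x U)
      (∑ j, C (V⁻¹ j l) * (X j - C (y j)))) (frameSubst y V f) := by
    conv_lhs => rw [← frameSubstInv_frameSubst y V hV f]
    rw [← AlgHom.comp_apply, frameSubstInv, ← AlgHom.comp_apply, comp_aeval]
  rw [key]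
  refine aeval_mem_ideal_pow (linePointIdeal σ s) _ (fun l => ?_) (frameSubst y V f) k hk
  rw [map_sum]
  refine Ideal.sum_mem _ fun j _ => ?_
  rw [map_mul]
  refine Ideal.mul_mem_left _ _ ?_
  have h1 : ((absorbVar i).comp (frameSubst x U)) (X j - C (y j)) =
      ∑ l, C (Polynomial.C (U l j)) *
        ((if l = i then C (Polynomial.X - Polynomial.C s) else X l) :
          MvPolynomial σ (Polynomial ℝ)) := by
    have h2 : ∀ l, (C (Polynomial.C (U l j)) *
        ((if l = i then C (Polynomial.X - Polynomial.C s) else X l) :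
          MvPolynomial σ (Polynomial ℝ))) = C (Polynomial.C (U l j)) *
        (if l = i then C Polynomial.X else X l) -
        if l = i then C (Polynomial.C (s * U i j)) else 0 := by
      intro l
      split_ifs with hl
      · subst hl; simp only [C_sub, C_mul, Polynomial.C_mul]; ring
      · simp
    rw [Finset.sum_congr rfl fun l _ => h2 l, Finset.sum_sub_distrib, Finset.sum_ite_eq',
      if_pos (Finset.mem_univ i), hy]
    simp only [AlgHom.comp_apply, frameSubst, absorbVar, map_sub, aeval_X, map_add, map_sum,
      map_mul, algHom_C, algebraMap_eq, Pi.add_apply, Pi.smul_apply, smul_eq_mul]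
    have h3 : ∀ r : ℝ, algebraMap ℝ (MvPolynomial σ (Polynomial ℝ)) r = C (Polynomial.C r) :=
      fun r => rfl
    simp only [h3]
    ring
  rw [h1]
  refine Ideal.sum_mem _ fun l _ => Ideal.mul_mem_left _ _ ?_
  split_ifs
  · exact Ideal.subset_span (Set.mem_insert _ _)
  · exact Ideal.subset_span (Set.mem_insert_of_mem _ ⟨l, rfl⟩)

end AdaptedCoordinates

section Counting

/-! ### Parameter counting, zero counting and pruning. -/

open MvPolynomial

variable {σ J : Type*} [Fintype σ] [DecidableEq σ] [Fintype J]

omit [Fintype J] in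
/-- A polynomial of degree at most `n` whose Taylor coefficients vanish on a large box at each
point of a configuration is zero. -/
theorem eq_zero_of_coeff_frameSubst_eq_zero [Nonempty J] (x : J → σ → ℝ)
    (hx : Function.Injective x) (U : J → Matrix σ σ ℝ) (hU : ∀ p, IsUnit (U p).det) (m : σ → ℕ)
    (hfib : ∀ p i, ∃ S : Finset J, m i ≤ S.card ∧ ∀ q ∈ S, ∃ s : ℝ, x q = x p + s • U p i)
    (B : σ → ℕ) (n : ℕ) (hB : ∀ i, n < m i * B i) (f : MvPolynomial σ ℝ)
    (hf : f.totalDegree ≤ n)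
    (hbox : ∀ p, ∀ e : σ →₀ ℕ, (∀ i, e i < B i) → coeff e (frameSubst (x p) (U p) f) = 0) :
    f = 0 := by
  by_contra hf0
  have hne : ∀ p, frameSubst (x p) (U p) f ≠ 0 := fun p h0 => hf0 <| by
    rw [← frameSubstInv_frameSubst (x p) (U p) (hU p) f, h0, map_zero]
  -- The minimum is over all joints at once, so `f` vanishes to order `e.degree` at every joint,
  -- including those on the line used below.
  let T : Set ℕ := {k | ∃ p, ∃ e ∈ (frameSubst (x p) (U p) f).support, e.degree = k}
  have hT : T.Nonempty := by
    obtain ⟨p⟩ := ‹Nonempty J›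
    obtain ⟨e, he⟩ := support_nonempty.2 (hne p)
    exact ⟨_, p, e, he, rfl⟩
  obtain ⟨p, e, he, hek⟩ := Nat.sInf_mem hT
  have hmin : ∀ q, ∀ e' ∈ (frameSubst (x q) (U q) f).support, e.degree ≤ e'.degree :=
    fun q e' he' => hek ▸ Nat.sInf_le ⟨q, e', he', rfl⟩
  obtain ⟨i, hi⟩ : ∃ i, B i ≤ e i := by
    by_contra! h
    exact mem_support_iff.1 he (hbox p e h)
  obtain ⟨S, hS, hs⟩ := hfib p i
  choose! s hs using hs
  set r := coeff (e.erase i) (absorbVar i (frameSubst (x p) (U p) f)) with hr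
  have hr0 : r ≠ 0 := fun h0 => mem_support_iff.1 he <| by
    rw [← coeff_coeff_absorbVar i, ← hr, h0, Polynomial.coeff_zero]
  have hdeg : e.degree - (e.erase i).degree = e i := by
    conv_lhs => rw [← Finsupp.erase_add_single i e]
    simp
  have h1 : S.card * e i ≤ r.natDegree := by
    refine Polynomial.card_mul_le_natDegree_of_X_sub_C_pow_dvd hr0 S s ?_ _ fun q hq => ?_
    · intro q hq q' hq' h
      exact hx (by rw [hs q hq, hs q' hq', h])
    · rw [← hdeg]
      exact pow_dvd_coeff_absorbVar_frameSubst (x p) (x q) (U p) (U q) (hU q) i (s q) (hs q hq) f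
        _ (hmin q) _
  have h2 : r.natDegree ≤ n :=
    (natDegree_coeff_absorbVar_le i _ _).trans ((totalDegree_frameSubst_le _ _ f).trans hf)
  have h3 := hB i
  have h4 := Nat.mul_le_mul hS hi
  omega

/-- Parameter counting: there is a nonzero polynomial satisfying fewer box vanishing conditions
than there are monomials with exponents at most `M`. -/
theorem exists_ne_zero_coeff_frameSubst_eq_zero (x : J → σ → ℝ) (U : J → Matrix σ σ ℝ)
    (B : σ → ℕ) (M : ℕ) (h : Fintype.card J * ∏ i, B i < (M + 1) ^ Fintype.card σ) :
    ∃ f : MvPolynomial σ ℝ, f ≠ 0 ∧ f.totalDegree ≤ Fintype.card σ * M ∧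
      ∀ p, ∀ e : σ →₀ ℕ, (∀ i, e i < B i) → coeff e (frameSubst (x p) (U p) f) = 0 := by
  let v : (σ → Fin (M + 1)) → σ →₀ ℕ := fun a => Finsupp.equivFunOnFinite.symm fun i => (a i : ℕ)
  have hv : Function.Injective v := fun a b hab => by
    funext i
    exact Fin.ext (DFunLike.congr_fun hab i)
  let P : ((σ → Fin (M + 1)) → ℝ) →ₗ[ℝ] MvPolynomial σ ℝ :=
    Fintype.linearCombination ℝ fun a => monomial (v a) 1
  let w : (∀ i, Fin (B i)) → σ →₀ ℕ := fun a => Finsupp.equivFunOnFinite.symm fun i => (a i : ℕ)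
  let L : ((σ → Fin (M + 1)) → ℝ) →ₗ[ℝ] (J × (∀ i, Fin (B i)) → ℝ) :=
    LinearMap.pi fun t => lcoeff ℝ (w t.2) ∘ₗ (frameSubst (x t.1) (U t.1)).toLinearMap ∘ₗ P
  have hL : LinearMap.ker L ≠ ⊥ := by
    apply LinearMap.ker_ne_bot_of_finrank_lt
    simpa using h
  obtain ⟨c, hc, hc0⟩ := (Submodule.ne_bot_iff _).1 hL
  have hP : ∀ a, coeff (v a) (P c) = c a := by
    intro a
    simp only [P, Fintype.linearCombination_apply, coeff_sum, coeff_smul, coeff_monomial,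
      smul_eq_mul]
    rw [Finset.sum_eq_single a]
    · simp
    · intro b _ hb
      rw [if_neg (hv.ne hb), mul_zero]
    · simp
  refine ⟨P c, fun h0 => hc0 ?_, ?_, fun p e he => ?_⟩
  · funext a
    rw [← hP a, h0, coeff_zero, Pi.zero_apply]
  · simp only [P, Fintype.linearCombination_apply]
    refine totalDegree_finsetSum_le fun a _ => (totalDegree_smul_le _ _).trans ?_
    refine (totalDegree_monomial_le _ _).trans ?_
    rw [Finsupp.sum_fintype _ _ fun _ => rfl]
    refine (Finset.sum_le_card_nsmul _ _ M fun i _ => ?_).trans (by simp)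
    exact Nat.lt_succ_iff.1 (a i).2
  · have h1 := congrFun (LinearMap.mem_ker.1 hc) (p, fun i => ⟨e i, he i⟩)
    have h2 : w (fun i => ⟨e i, he i⟩) = e := by ext i; rfl
    simpa [L, h2] using h1

/-- If every line of the `i`-th family carries at least `m i` of the joints, then the product of
the `m i` is at most a constant times the number of joints. -/
theorem prod_le_card_of_fibers [Nonempty J] (x : J → σ → ℝ)
    (hx : Function.Injective x) (U : J → Matrix σ σ ℝ) (hU : ∀ p, IsUnit (U p).det) (m : σ → ℕ)
    (hm : ∀ i, 0 < m i)
    (hfib : ∀ p i, ∃ S : Finset J, m i ≤ S.card ∧ ∀ q ∈ S, ∃ s : ℝ, x q = x p + s • U p i) :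
    ∏ i, m i ≤ (Fintype.card σ + 1) ^ Fintype.card σ * Fintype.card J := by
  set d := Fintype.card σ with hd
  set M := ∏ i, m i with hM
  by_contra! hlt
  have hMpos : 0 < M := Finset.prod_pos fun i _ => hm i
  have hdvd : ∀ i, m i ∣ M := fun i => Finset.dvd_prod_of_mem _ (Finset.mem_univ i)
  choose b hb using hdvd
  have hbpos : ∀ i, 0 < b i := fun i => Nat.pos_of_ne_zero fun h0 => by
    have := hb i; rw [h0, mul_zero] at this; omega
  -- Since `b i = M / m i`, every `m i * B i` equals `(d + 1) * M`, just above the available degree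
  -- `d * M`.
  let B : σ → ℕ := fun i => (d + 1) * b i
  have hBprod : M * ∏ i, B i = (d + 1) ^ d * M ^ d := by
    rw [hM, ← Finset.prod_mul_distrib, ← hM,
      Finset.prod_congr rfl fun i _ => show m i * B i = (d + 1) * M by
        rw [hb i]; simp only [B]; ring,
      Finset.prod_const, Finset.card_univ, ← hd, mul_pow]
  have hcount : Fintype.card J * ∏ i, B i < (M + 1) ^ d := by
    have h1 : 0 < ∏ i, B i := Finset.prod_pos fun i _ => Nat.mul_pos d.succ_pos (hbpos i)
    have h2 : (d + 1) ^ d * (Fintype.card J * ∏ i, B i) < (d + 1) ^ d * M ^ d := by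
      rw [← hBprod, ← mul_assoc]
      exact Nat.mul_lt_mul_of_pos_right hlt h1
    exact (Nat.lt_of_mul_lt_mul_left h2).trans_le (Nat.pow_le_pow_left (Nat.le_succ M) d)
  obtain ⟨f, hf0, hfdeg, hfbox⟩ := exists_ne_zero_coeff_frameSubst_eq_zero x U B M hcount
  refine hf0 (eq_zero_of_coeff_frameSubst_eq_zero x hx U hU m hfib B _ (fun i => ?_) f hfdeg hfbox)
  have : m i * B i = (d + 1) * M := by rw [hb i]; simp only [B]; ring
  rw [this]
  exact Nat.mul_lt_mul_of_pos_right d.lt_succ_self hMpos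

/-- Every finite set with finitely many labellings has a nonempty subset on which all the fibres
of the labellings are large. -/
theorem exists_subset_large_fibers {α β : Type*} [DecidableEq α] [DecidableEq β] (s : Finset α)
    (l : σ → α → β) (t : σ → ℝ) (ht : ∀ i, 0 ≤ t i)
    (h : ∑ i, t i * ((s.image (l i)).card : ℝ) < s.card) :
    ∃ u ⊆ s, u.Nonempty ∧ ∀ p ∈ u, ∀ i, t i ≤ ((u.filter fun q => l i q = l i p).card : ℝ) := by
  -- Each label in use costs `t i`. The maximum is positive because `Φ s > 0`, while `Φ ∅ = 0`.
  let Φ : Finset α → ℝ := fun u => u.card - ∑ i, t i * ((u.image (l i)).card : ℝ)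
  obtain ⟨u, hu, hmax⟩ := Finset.exists_max_image s.powerset Φ ⟨s, Finset.mem_powerset_self s⟩
  refine ⟨u, Finset.mem_powerset.1 hu, ?_, fun p hp i => ?_⟩
  · by_contra hu0
    rw [Finset.not_nonempty_iff_eq_empty] at hu0
    have := hmax s (Finset.mem_powerset_self s)
    simp only [Φ, hu0, Finset.card_empty, Finset.image_empty, Nat.cast_zero, mul_zero,
      Finset.sum_const_zero] at this
    linarith
  · by_contra! hlt
    -- Deleting a fibre with fewer than `t i` points frees a label worth `t i`, which would increase
    -- `Φ`.
    set u' := u.filter fun q => ¬ l i q = l i p with hu'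
    have h1 := hmax u' (Finset.mem_powerset.2
      ((Finset.filter_subset _ _).trans (Finset.mem_powerset.1 hu)))
    have hcard : ((u.filter fun q => l i q = l i p).card : ℝ) + u'.card = u.card := by
      exact_mod_cast Finset.card_filter_add_card_filter_not (s := u) fun q => l i q = l i p
    have himg : ∀ j, ((u'.image (l j)).card : ℝ) ≤ (u.image (l j)).card := fun j => by
      exact_mod_cast Finset.card_le_card (Finset.image_subset_image (Finset.filter_subset _ _))
    have himg' : ((u'.image (l i)).card : ℝ) + 1 ≤ (u.image (l i)).card := by
      have : (u'.image (l i)).card < (u.image (l i)).card := by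
        refine Finset.card_lt_card ((Finset.ssubset_iff_of_subset
          (Finset.image_subset_image (Finset.filter_subset _ _))).2
          ⟨l i p, Finset.mem_image_of_mem _ hp, fun hmem => ?_⟩)
        obtain ⟨q, hq, hqp⟩ := Finset.mem_image.1 hmem
        exact (Finset.mem_filter.1 hq).2 hqp
      exact_mod_cast this
    have hsum : ∑ j, t j * ((u'.image (l j)).card : ℝ) + t i ≤
        ∑ j, t j * ((u.image (l j)).card : ℝ) := by
      rw [← Finset.add_sum_erase _ _ (Finset.mem_univ i),
        ← Finset.add_sum_erase Finset.univ (fun j => t j * ((u.image (l j)).card : ℝ))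
          (Finset.mem_univ i)]
      have h2 := Finset.sum_le_sum fun j (_ : j ∈ Finset.univ.erase i) =>
        mul_le_mul_of_nonneg_left (himg j) (ht j)
      have h3 := mul_le_mul_of_nonneg_left himg' (ht i)
      linarith
    simp only [Φ] at h1
    linarith

end Counting

/-! ### From lines to frames, and the final estimate. -/

section Lines

/-- Three lines whose directions span `ℝ³` have direction vectors forming an invertible matrix. -/
theorem exists_isUnit_det_direction_eq_span
    (l : Fin 3 → AffineSubspace ℝ (EuclideanSpace ℝ (Fin 3))) (hl : ∀ i, IsLine (l i))
    (htop : ⨆ i, (l i).direction = ⊤) :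
    ∃ U : Matrix (Fin 3) (Fin 3) ℝ, IsUnit U.det ∧
      ∀ i, (l i).direction = Submodule.span ℝ {WithLp.toLp 2 (U i)} := by
  have h1 : ∀ i, ∃ v : EuclideanSpace ℝ (Fin 3), (l i).direction = Submodule.span ℝ {v} := by
    intro i
    obtain ⟨v, hv0, hv⟩ := finrank_eq_one_iff'.1 (hl i)
    refine ⟨v, le_antisymm (fun w hw => ?_) ?_⟩
    · obtain ⟨c, hc⟩ := hv ⟨w, hw⟩
      exact Submodule.mem_span_singleton.2 ⟨c, congrArg Subtype.val hc⟩
    · rw [Submodule.span_singleton_le_iff_mem]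
      exact v.2
  choose v hv using h1
  have hspan : ⊤ ≤ Submodule.span ℝ (Set.range v) := by
    rw [← htop]
    refine iSup_le fun i => ?_
    rw [hv i]
    exact Submodule.span_mono (Set.singleton_subset_iff.2 ⟨i, rfl⟩)
  have hli : LinearIndependent ℝ v :=
    linearIndependent_of_top_le_span_of_card_eq_finrank hspan (by simp)
  refine ⟨Matrix.of fun i => (v i).ofLp, ?_, hv⟩
  rw [← Matrix.isUnit_iff_isUnit_det, ← Matrix.linearIndependent_rows_iff_isUnit]
  exact hli.map' (WithLp.linearEquiv 2 ℝ (Fin 3 → ℝ)).toLinearMap (LinearEquiv.ker _)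

/-- Three lines whose directions span `ℝ³` have at most one common point. -/
theorem eq_of_mem_lines (l : Fin 3 → AffineSubspace ℝ (EuclideanSpace ℝ (Fin 3)))
    (hl : ∀ i, IsLine (l i)) (htop : ⨆ i, (l i).direction = ⊤) {x y : EuclideanSpace ℝ (Fin 3)}
    (hx : ∀ i, x ∈ l i) (hy : ∀ i, y ∈ l i) : x = y := by
  by_contra hne
  have hv : x - y ≠ 0 := sub_ne_zero.2 hne
  have h1 : (⊤ : Submodule ℝ (EuclideanSpace ℝ (Fin 3))) ≤ Submodule.span ℝ {x - y} := by
    rw [← htop]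
    refine iSup_le fun i w hw => ?_
    have hm : x - y ∈ (l i).direction := AffineSubspace.vsub_mem_direction (hx i) (hy i)
    obtain ⟨c, hc⟩ := (finrank_eq_one_iff_of_nonzero' (⟨x - y, hm⟩ : (l i).direction)
      (fun h0 => hv (congrArg Subtype.val h0))).1 (hl i) ⟨w, hw⟩
    exact Submodule.mem_span_singleton.2 ⟨c, congrArg Subtype.val hc⟩
  have h2 := Submodule.finrank_mono h1
  rw [finrank_top, finrank_span_singleton hv, finrank_euclideanSpace_fin] at h2
  omega

/-- The multijoint bound for three families of lines indexed by `Fin 3`. -/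
theorem multijoints_finite_and_card_sq_le
    (F : Fin 3 → Finset (AffineSubspace ℝ (EuclideanSpace ℝ (Fin 3))))
    (hF : ∀ i, ∀ l ∈ F i, IsLine l) (P : Set (EuclideanSpace ℝ (Fin 3)))
    (hP : ∀ x ∈ P, ∃ l : Fin 3 → AffineSubspace ℝ (EuclideanSpace ℝ (Fin 3)),
      (∀ i, l i ∈ F i) ∧ (∀ i, x ∈ l i) ∧ ⨆ i, (l i).direction = ⊤) :
    P.Finite ∧ (P.ncard : ℝ) ^ 2 ≤ 64 ^ 2 * ∏ i, ((F i).card : ℝ) := by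
  classical
  -- One triple of lines is fixed per joint; fibres count only joints that chose the line.
  choose! l hlF hxl htop using hP
  have hfin : P.Finite := by
    refine Set.Finite.of_injOn (f := l) (t := Set.univ.pi fun i => (F i : Set _))
      (fun x hx i _ => hlF x hx i) (fun x hx y hy hxy => ?_)
      (Set.Finite.pi fun i => (F i).finite_toSet)
    exact eq_of_mem_lines (l x) (fun i => hF i _ (hlF x hx i)) (htop x hx) (hxl x hx)
      (hxy ▸ hxl y hy)
  refine ⟨hfin, ?_⟩
  rw [Set.ncard_eq_toFinset_card P hfin]
  set S := hfin.toFinset with hS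
  have hSP : ∀ x ∈ S, x ∈ P := fun x hx => hfin.mem_toFinset.1 hx
  rcases S.eq_empty_or_nonempty with h0 | ⟨x₀, hx₀⟩
  · rw [h0, Finset.card_empty, Nat.cast_zero, zero_pow two_ne_zero]
    exact mul_nonneg (by norm_num) (Finset.prod_nonneg fun i _ => Nat.cast_nonneg _)
  have hN : (0 : ℝ) < S.card := by exact_mod_cast Finset.card_pos.2 ⟨x₀, hx₀⟩
  have hL : ∀ i, (0 : ℝ) < (F i).card := fun i => by
    exact_mod_cast Finset.card_pos.2 ⟨_, hlF x₀ (hSP x₀ hx₀) i⟩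
  -- With the factor 4 the three label costs total at most `3/4` of `S.card`, strictly less than
  -- `S.card`.
  let t : Fin 3 → ℝ := fun i => S.card / (4 * (F i).card)
  have ht : ∀ i, 0 < t i := fun i => div_pos hN (mul_pos four_pos (hL i))
  obtain ⟨u, huS, hune, hu⟩ := exists_subset_large_fibers S (fun i x => l x i) t
    (fun i => (ht i).le) (by
      have h1 : ∀ i ∈ (Finset.univ : Finset (Fin 3)),
          t i * ((S.image fun x => l x i).card : ℝ) ≤ S.card / 4 := by
        intro i _
        have h2 : ((S.image fun x => l x i).card : ℝ) ≤ (F i).card := by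
          exact_mod_cast Finset.card_le_card
            (Finset.image_subset_iff.2 fun x hx => hlF x (hSP x hx) i)
        calc t i * ((S.image fun x => l x i).card : ℝ) ≤ t i * (F i).card :=
              mul_le_mul_of_nonneg_left h2 (ht i).le
          _ = S.card / 4 := by
              have := (hL i).ne'
              simp only [t]; field_simp
      have h3 := Finset.sum_le_sum h1
      rw [Finset.sum_const, Finset.card_univ, Fintype.card_fin, nsmul_eq_mul] at h3
      push_cast at h3
      linarith)
  have huP : ∀ p : u, (p : EuclideanSpace ℝ (Fin 3)) ∈ P := fun p => hSP _ (huS p.2)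
  choose U hU hUspan using fun p : u => exists_isUnit_det_direction_eq_span (l p)
    (fun i => hF i _ (hlF p (huP p) i)) (htop p (huP p))
  have : Nonempty u := hune.to_subtype
  have key := prod_le_card_of_fibers (fun p : u => (p : EuclideanSpace ℝ (Fin 3)).ofLp)
    (fun p q h => Subtype.ext (WithLp.ofLp_injective 2 h)) U hU (fun i => ⌈t i⌉₊)
    (fun i => Nat.ceil_pos.2 (ht i)) (fun p i => by
      refine ⟨Finset.univ.filter fun q : u => l q i = l p i, ?_, fun q hq => ?_⟩
      · refine Nat.ceil_le.2 ((hu p p.2 i).trans ?_)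
        have h1 : u.filter (fun q => l q i = l p i) ⊆
            (Finset.univ.filter fun q : u => l q i = l p i).image Subtype.val := by
          intro q hq
          obtain ⟨hqu, hql⟩ := Finset.mem_filter.1 hq
          exact Finset.mem_image.2 ⟨⟨q, hqu⟩, Finset.mem_filter.2 ⟨Finset.mem_univ _, hql⟩, rfl⟩
        exact_mod_cast (Finset.card_le_card h1).trans Finset.card_image_le
      · have hq' : (q : EuclideanSpace ℝ (Fin 3)) ∈ l p i :=
          (Finset.mem_filter.1 hq).2 ▸ hxl q (huP q) i
        have h2 := AffineSubspace.vsub_mem_direction hq' (hxl p (huP p) i)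
        rw [hUspan p i] at h2
        obtain ⟨s, hs⟩ := Submodule.mem_span_singleton.1 h2
        refine ⟨s, ?_⟩
        have h3 := congrArg WithLp.ofLp hs
        simp only [vsub_eq_sub, WithLp.ofLp_sub, WithLp.ofLp_smul] at h3
        rw [h3]
        abel)
  have h1 : ∏ i, t i ≤ 64 * S.card := by
    calc ∏ i, t i ≤ ∏ i, ((⌈t i⌉₊ : ℕ) : ℝ) :=
          Finset.prod_le_prod (fun i _ => (ht i).le) fun i _ => Nat.le_ceil _
      _ ≤ 64 * (u.card : ℝ) := by
          rw [Fintype.card_fin, Fintype.card_coe] at key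
          exact_mod_cast key
      _ ≤ 64 * S.card := by
          have := Finset.card_le_card huS
          gcongr
  simp only [t, Fin.prod_univ_three] at h1 ⊢
  have hL0 := hL 0
  have hL1 := hL 1
  have hL2 := hL 2
  -- One factor `64 = 4 ^ 3` comes from the thresholds `t i`, the other from `(d + 1) ^ d` with `d =
  -- 3`.
  rw [div_mul_div_comm, div_mul_div_comm, div_le_iff₀ (by positivity)] at h1
  refine le_of_mul_le_mul_left ?_ hN
  nlinarith

end Lines

/-- The number of multijoints formed by three finite collections of lines in `ℝ³` is at most an
absolute constant times the square root of the product of the numbers of lines. -/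
theorem theorem1 :
    ∃ c : ℝ, 0 < c ∧
      ∀ A B C : Finset (AffineSubspace ℝ (EuclideanSpace ℝ (Fin 3))),
        (∀ l ∈ A, IsLine l) → (∀ l ∈ B, IsLine l) → (∀ l ∈ C, IsLine l) →
          (multijoints (A : Set _) (B : Set _) (C : Set _)).Finite ∧
          ((multijoints (A : Set _) (B : Set _) (C : Set _)).ncard : ℝ) ≤
            c * Real.sqrt ((A.card : ℝ) * (B.card : ℝ) * (C.card : ℝ)) := by
  refine ⟨64, by norm_num, fun A B C hA hB hC => ?_⟩
  obtain ⟨hfin, hcard⟩ := multijoints_finite_and_card_sq_le ![A, B, C]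
    (Fin.forall_fin_succ.2 ⟨hA, Fin.forall_fin_two.2 ⟨hB, hC⟩⟩)
    (multijoints (A : Set _) (B : Set _) (C : Set _)) (by
      rintro x ⟨l₁, h₁, l₂, h₂, l₃, h₃, hx₁, hx₂, hx₃, htop⟩
      refine ⟨![l₁, l₂, l₃], Fin.forall_fin_succ.2 ⟨h₁, Fin.forall_fin_two.2 ⟨h₂, h₃⟩⟩,
        Fin.forall_fin_succ.2 ⟨hx₁, Fin.forall_fin_two.2 ⟨hx₂, hx₃⟩⟩, ?_⟩
      rw [eq_top_iff, ← htop]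
      exact sup_le (sup_le (le_iSup (fun i => (![l₁, l₂, l₃] i).direction) 0)
        (le_iSup (fun i => (![l₁, l₂, l₃] i).direction) 1))
        (le_iSup (fun i => (![l₁, l₂, l₃] i).direction) 2))
  refine ⟨hfin, ?_⟩
  rw [Fin.prod_univ_three] at hcard
  refine (sq_le_sq₀ (Nat.cast_nonneg _) (mul_nonneg (by norm_num) (Real.sqrt_nonneg _))).1 ?_
  rw [mul_pow, Real.sq_sqrt (by positivity)]
  exact hcard
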